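/- Let $p$ be a prime. A partition is a sequence of nonnegative integers $\lambda_1\ge\lambda_2\ge\cdots$ that is eventually $0$; write $\lambda_i'=\#\{j:\lambda_j\ge i\}$, $|\lambda|=\sum_i\lambda_i$, $n(\lambda)=\sum_{i\ge1}(i-1)\lambda_i$ and $G_\lambda=\bigoplus_i\mathbb{Z}/p^{\lambda_i}\mathbb{Z}$. Write $(a;q)_n=\prod_{i=1}^n(1-aq^{i-1})$, and let $\operatorname{Sur}(G,H)$ be the set of surjective group homomorphisms $G\to H$. Let $G$ be a random finite abelian $p$-group (considered up to isomorphism) such that $M_H:=\mathbb{E}[\#\operatorname{Sur}(G,H)]$ is finite for every finite abelian $p$-group $H$. Then for every partition $\nu$, $$\Pr(G\cong G_\nu)=\sum_{\mu:\ \mu_1'\ge\nu_1'\ge\mu_2'\ge\nu_2'\ge\cdots}\frac{(-1)^{|\mu|-|\nu|}\,p^{-n(\nu)-n(\mu)-|\mu|}}{\prod_{i\ge1}(p^{-1};p^{-1})_{\mu_i'-\nu_i'}\,(p^{-1};p^{-1})_{\nu_i'-\mu_{i+1}'}}\,M_{G_\mu},$$ where $\mu$ ranges over partitions, provided that the sum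 on the right-hand side converges absolutely. Furthermore, if this sum converges absolutely for every partition $\nu$, then the law of $G$ is the unique probability measure on the set of isomorphism classes of finite abelian $p$-groups whose $H$-moment equals $M_H$ for every finite abelian $p$-group $H$. -/

import Mathlib

open MeasureTheory

noncomputable section

/-- The `q`-Pochhammer symbol `(a;q)_n = ∏_{i=1}^n (1 - a q^{i-1})`. -/
def qPoch (a q : ℝ) (n : ℕ) : ℝ := ∏ i ∈ Finset.range n, (1 - a * q ^ i)

/-! Integer partitions are Young diagrams. With rows and columns indexed from `0`, the part
`λ_{i+1}` is `l.rowLen i`, the conjugate part `λ'_{i+1} = #{j : λ_j ≥ i + 1}` is `l.colLen i`,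
and `|λ| = ∑ λ_i` is `l.card`. -/

/-- `n(λ) = ∑_{i ≥ 1} (i - 1) λ_i`; there are `l.colLen 0` nonzero parts. -/
def partitionN (l : YoungDiagram) : ℕ := ∑ i ∈ Finset.range (l.colLen 0), i * l.rowLen i

/-- `μ'_1 ≥ ν'_1 ≥ μ'_2 ≥ ν'_2 ≥ ⋯`, that is, `μ' ≻ ν'`. -/
def ConjInterlace (μ ν : YoungDiagram) : Prop :=
  ∀ i : ℕ, ν.colLen i ≤ μ.colLen i ∧ μ.colLen (i + 1) ≤ ν.colLen i

/-- The coefficient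
`(-1)^{|μ|-|ν|} p^{-n(ν)-n(μ)-|μ|} / ∏_{i ≥ 1} (p⁻¹;p⁻¹)_{μ'_i-ν'_i} (p⁻¹;p⁻¹)_{ν'_i-μ'_{i+1}}`.
It is used only when `μ' ≻ ν'`: then none of the natural-number subtractions truncates, and
since `μ'_i = ν'_i = 0` for `i > μ_1`, the factors of the product with `i > μ_1` equal `1`. -/
def inversionCoeff (p : ℕ) (μ ν : YoungDiagram) : ℝ :=
  ((-1 : ℝ) ^ (μ.card - ν.card) *
      ((p : ℝ)⁻¹) ^ (partitionN ν + partitionN μ + μ.card)) /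
    ∏ i ∈ Finset.range (μ.rowLen 0),
      (qPoch (p : ℝ)⁻¹ (p : ℝ)⁻¹ (μ.colLen i - ν.colLen i) *
        qPoch (p : ℝ)⁻¹ (p : ℝ)⁻¹ (ν.colLen i - μ.colLen (i + 1)))

/-- Finite abelian `p`-groups (written additively). -/
structure FinAbPGroup (p : ℕ) where
  carrier : Type
  [addCommGroup : AddCommGroup carrier]
  [finite : Finite carrier]
  isPGroup : IsPGroup p (Multiplicative carrier)

attribute [instance] FinAbPGroup.addCommGroup FinAbPGroup.finite

/-- Isomorphism of finite abelian `p`-groups. -/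
instance FinAbPGroup.isoSetoid (p : ℕ) : Setoid (FinAbPGroup p) where
  r A B := Nonempty (A.carrier ≃+ B.carrier)
  iseqv :=
    { refl := fun A => ⟨AddEquiv.refl A.carrier⟩
      symm := fun ⟨e⟩ => ⟨e.symm⟩
      trans := fun ⟨e⟩ ⟨f⟩ => ⟨e.trans f⟩ }

/-- The set of isomorphism classes of finite abelian `p`-groups. -/
def FinAbPGroupClass (p : ℕ) : Type 1 := Quotient (FinAbPGroup.isoSetoid p)

/-- The isomorphism class of a finite abelian `p`-group. -/
def FinAbPGroup.isoClass {p : ℕ} (A : FinAbPGroup p) : FinAbPGroupClass p :=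
  Quotient.mk (FinAbPGroup.isoSetoid p) A

/-- The (countable) set of isomorphism classes carries the discrete `σ`-algebra. -/
instance (p : ℕ) : MeasurableSpace (FinAbPGroupClass p) := ⊤

/-- The group `G_λ = ⨁_i ℤ/p^{λ_i}ℤ`; the zero parts contribute trivial summands. -/
def partitionGroup (p : ℕ) [Fact p.Prime] (l : YoungDiagram) : FinAbPGroup p where
  carrier := (i : Fin (l.colLen 0)) → ZMod (p ^ l.rowLen i)
  finite := by
    have : ∀ i : Fin (l.colLen 0), NeZero (p ^ l.rowLen i) :=
      fun i => ⟨pow_ne_zero _ (Fact.out : p.Prime).ne_zero⟩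
    infer_instance
  isPGroup := by
    refine IsPGroup.of_card (n := ∑ i : Fin (l.colLen 0), l.rowLen i) ?_
    rw [Nat.card_congr Multiplicative.toAdd, Nat.card_pi]
    simp [Finset.prod_pow_eq_pow_sum]

/-- The number `#Sur(A, B)` of surjective group homomorphisms `A → B`. -/
def FinAbPGroup.numSur {p : ℕ} (A B : FinAbPGroup p) : ℕ :=
  Nat.card {f : A.carrier →+ B.carrier // Function.Surjective f}

theorem FinAbPGroup.numSur_congr {p : ℕ} {A₁ A₂ : FinAbPGroup p}
    (e : A₁.carrier ≃+ A₂.carrier) (B : FinAbPGroup p) : A₁.numSur B = A₂.numSur B :=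
  Nat.card_congr
    { toFun := fun f => ⟨f.1.comp e.symm.toAddMonoidHom, f.2.comp e.symm.surjective⟩
      invFun := fun f => ⟨f.1.comp e.toAddMonoidHom, f.2.comp e.surjective⟩
      left_inv := fun f => by ext x; simp
      right_inv := fun f => by ext x; simp }

/-- `#Sur(A, B)` as a function of the isomorphism class of `A`. -/
def FinAbPGroupClass.numSur {p : ℕ} (A : FinAbPGroupClass p) (B : FinAbPGroup p) : ℕ :=
  Quotient.lift (fun A : FinAbPGroup p => A.numSur B)
    (fun _ _ h => FinAbPGroup.numSur_congr (Nonempty.some h) B) A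

/-- The `H`-moment `𝔼[#Sur(G, H)] ∈ [0, ∞]` of a random finite abelian `p`-group `G`, a random
variable with values in the isomorphism classes. -/
def groupMoment {p : ℕ} {Ω : Type*} [MeasurableSpace Ω] (P : Measure Ω)
    (G : Ω → FinAbPGroupClass p) (H : FinAbPGroup p) : ENNReal :=
  ∫⁻ ω, ((G ω).numSur H : ENNReal) ∂P

end

open MeasureTheory

noncomputable section

/-! Put `q = 1/p`. Everything reduces to an orthogonality relation: for fixed λ and ν, the sum over
μ of `inversionCoeff p μ ν` times #Sur(G_λ, G_μ) is 1 if λ = ν and 0 otherwise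
(`hasSum_inversionCoeff_mul_numSur`). Taking λ to be the type of the random group and then
expectations gives the inversion formula. Since #Sur is nonnegative, absolute convergence of the
moment sum is exactly what allows expectation and sum to be exchanged. Uniqueness follows because
the formula recovers every point mass from the moments.

The relation rests on two facts. Let a, b, c be the column lengths of λ, μ, ν. Then #Sur(G_λ, G_μ)
is the product over i of p^(a_i b_i) (q;q)_{a_i - b_{i+1}} / (q;q)_{a_i - b_i}
(`card_surjective_eq_prod`): restrict a surjection A → B to pA → pB and count by linear algebra the
surjections over a given restriction. Multiplied by the coefficient, this becomes a product whose
i-th factor involves b_i and the fixed a and c, but no other entry of b. The sum over μ is therefore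
a product of one-variable sums. At the first column where a and c differ, that sum is empty or
vanishes by the q-binomial theorem (`sum_columnTerm_eq_zero`); if they never differ, every sum is 1.
-/

/-- `1 / (q;q)_{a-b}`, with value `0` when `a < b`. -/
def invPoch (q : ℝ) (a b : ℕ) : ℝ := if b ≤ a then (qPoch q q (a - b))⁻¹ else 0

theorem qPoch_succ (a q : ℝ) (n : ℕ) : qPoch a q (n + 1) = qPoch a q n * (1 - a * q ^ n) :=
  Finset.prod_range_succ _ _

theorem qPoch_self_pos {q : ℝ} (h0 : 0 ≤ q) (h1 : q < 1) (n : ℕ) : 0 < qPoch q q n := by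
  refine Finset.prod_pos fun i _ => ?_
  rw [← pow_succ']
  exact sub_pos.2 (pow_lt_one₀ h0 h1 (Nat.succ_ne_zero i))

theorem qPoch_sub_mul_prod (q : ℝ) {m n : ℕ} (h : n ≤ m) :
    qPoch q q (m - n) * ∏ i ∈ Finset.range n, (1 - q ^ (m - i)) = qPoch q q m := by
  induction n with
  | zero => simp
  | succ n ih =>
    rw [← ih (by omega), Finset.prod_range_succ, show m - n = m - (n + 1) + 1 by omega,
      qPoch_succ, ← pow_succ']
    ring

theorem prod_pow_sub_pow {p : ℝ} (hp : p ≠ 0) {m n : ℕ} (h : n ≤ m) :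
    ∏ i ∈ Finset.range n, (p ^ m - p ^ i) =
      p ^ (m * n) * ∏ i ∈ Finset.range n, (1 - p⁻¹ ^ (m - i)) := by
  rw [pow_mul, ← Finset.card_range n, ← Finset.prod_const, Finset.card_range,
    ← Finset.prod_mul_distrib]
  refine Finset.prod_congr rfl fun i hi => ?_
  have hi' : i ≤ m := (Finset.mem_range.1 hi).le.trans h
  rw [mul_sub, mul_one, inv_pow]
  congr 1
  rw [eq_mul_inv_iff_mul_eq₀ (pow_ne_zero _ hp), ← pow_add]
  congr 1
  omega

/-! ### Homomorphisms between elementary abelian p-groups -/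

section Elementary

variable {p : ℕ} [hp : Fact p.Prime]

theorem finrank_of_card {V : Type*} [AddCommGroup V] [Module (ZMod p) V] [Finite V] {m : ℕ}
    (h : Nat.card V = p ^ m) : Module.finrank (ZMod p) V = m := by
  rw [Module.natCard_eq_pow_finrank (K := ZMod p), Nat.card_zmod] at h
  exact Nat.pow_right_injective hp.out.two_le h

variable (p) in
theorem card_addMonoidHom_elementary {V W : Type*} [AddCommGroup V] [AddCommGroup W] [Finite V]
    [Finite W] (hV : ∀ x : V, p • x = 0) (hW : ∀ x : W, p • x = 0) {m n : ℕ}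
    (hm : Nat.card V = p ^ m) (hn : Nat.card W = p ^ n) :
    Nat.card (V →+ W) = p ^ (m * n) := by
  have _ : Module (ZMod p) V := AddCommGroup.zmodModule hV
  have _ : Module (ZMod p) W := AddCommGroup.zmodModule hW
  have e : (V →+ W) ≃ (V →ₗ[ZMod p] W) := (AddMonoidHom.toZModLinearMapEquiv p).toEquiv
  rw [Nat.card_congr e, Module.natCard_eq_pow_finrank (K := ZMod p) (V := V →ₗ[ZMod p] W), Nat.card_zmod,
    Module.finrank_linearMap,
    finrank_of_card hm, finrank_of_card hn]

theorem LinearMap.surjective_iff_linearIndependent_coord {K V W ι : Type*} [Field K]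
    [AddCommGroup V] [AddCommGroup W] [Module K V] [Module K W] [Finite ι]
    (b : Module.Basis ι K W) (f : V →ₗ[K] W) :
    Function.Surjective f ↔ LinearIndependent K (fun i => b.coord i ∘ₗ f) := by
  classical
  have := Fintype.ofFinite ι
  have hb : (fun i => b.coord i ∘ₗ f) = f.dualMap ∘ b.dualBasis := by
    funext i; rw [b.coe_dualBasis]; rfl
  rw [← LinearMap.dualMap_injective_iff, hb]
  constructor
  · intro h
    exact b.dualBasis.linearIndependent.map' _ (LinearMap.ker_eq_bot.2 h)
  · intro h
    have := b.dualBasis.injective_constr_of_linearIndependent (R₂ := K) h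
    have hc : b.dualBasis.constr K (f.dualMap ∘ b.dualBasis) = f.dualMap :=
      b.dualBasis.constr_self (S := K) f.dualMap
    rwa [hc] at this

theorem card_surjective_linearMap {V W : Type*} [AddCommGroup V] [AddCommGroup W]
    [Module (ZMod p) V] [Module (ZMod p) W] [Finite V] [Finite W] {m n : ℕ} (h : n ≤ m)
    (hm : Nat.card V = p ^ m) (hn : Nat.card W = p ^ n) :
    Nat.card {f : V →ₗ[ZMod p] W // Function.Surjective f} = ∏ i : Fin n, (p ^ m - p ^ i.val) := by
  -- In coordinates, surjections onto W are linearly independent n-tuples in the dual of V.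
  let b := Module.finBasisOfFinrankEq (ZMod p) W (finrank_of_card hn)
  let e : (V →ₗ[ZMod p] W) ≃ (Fin n → Module.Dual (ZMod p) V) :=
    { toFun := fun f i => b.coord i ∘ₗ f
      invFun := fun s => b.equivFun.symm.toLinearMap ∘ₗ LinearMap.pi s
      left_inv := fun f => by
        ext x
        apply b.equivFun.injective
        ext i
        simp
      right_inv := fun s => by
        ext i x
        simp [Module.Basis.coord_apply, Finsupp.single_apply] }
  have hd : Module.finrank (ZMod p) (Module.Dual (ZMod p) V) = m := by
    rw [Subspace.dual_finrank_eq, finrank_of_card hm]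
  have : Finite (Module.Dual (ZMod p) V) := Module.finite_of_finite (ZMod p)
  rw [Nat.card_congr (e.subtypeEquiv (q := fun s : Fin n → Module.Dual (ZMod p) V => LinearIndependent (ZMod p) s)
      fun f =>
      LinearMap.surjective_iff_linearIndependent_coord b f),
    card_linearIndependent (hd.symm ▸ h), hd, ZMod.card]

variable (p) in
theorem card_surjective_elementary {V W : Type*} [AddCommGroup V] [AddCommGroup W] [Finite V]
    [Finite W] (hV : ∀ x : V, p • x = 0) (hW : ∀ x : W, p • x = 0) {m n : ℕ}
    (hm : Nat.card V = p ^ m) (hn : Nat.card W = p ^ n) :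
    (Nat.card {f : V →+ W // Function.Surjective f} : ℝ) =
      (p : ℝ) ^ (m * n) * (qPoch (p : ℝ)⁻¹ (p : ℝ)⁻¹ m * invPoch (p : ℝ)⁻¹ m n) := by
  have hp0 : (p : ℝ) ≠ 0 := Nat.cast_ne_zero.2 hp.out.ne_zero
  by_cases h : n ≤ m
  · have _ : Module (ZMod p) V := AddCommGroup.zmodModule hV
    have _ : Module (ZMod p) W := AddCommGroup.zmodModule hW
    have e : {f : V →+ W // Function.Surjective f} ≃
        {f : V →ₗ[ZMod p] W // Function.Surjective f} :=
      (AddMonoidHom.toZModLinearMapEquiv p).toEquiv.subtypeEquiv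
        (q := fun f : V →ₗ[ZMod p] W => Function.Surjective f) fun f => Iff.rfl
    have hq := qPoch_self_pos (q := (p : ℝ)⁻¹) (by positivity)
      (inv_lt_one_of_one_lt₀ (Nat.one_lt_cast.2 hp.out.one_lt)) (m - n)
    rw [Nat.card_congr e, card_surjective_linearMap h hm hn, Nat.cast_prod,
      Fin.prod_univ_eq_prod_range (fun i => ((p ^ m - p ^ i : ℕ) : ℝ)) n, invPoch, if_pos h,
      ← qPoch_sub_mul_prod _ h, mul_right_comm, mul_inv_cancel₀ hq.ne', one_mul,
      ← prod_pow_sub_pow hp0 h]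
    refine Finset.prod_congr rfl fun i hi => ?_
    rw [Nat.cast_sub (Nat.pow_le_pow_right hp.out.pos ((Finset.mem_range.1 hi).le.trans h))]
    simp
  -- For n > m no surjection exists, matching the convention that `invPoch` is 0 there.
  · have : IsEmpty {f : V →+ W // Function.Surjective f} := ⟨fun f => h <| by
      have := Nat.card_le_card_of_surjective f.1 f.2
      rw [hm, hn] at this
      exact (Nat.pow_le_pow_iff_right hp.out.one_lt).1 this⟩
    simp [invPoch, h]

theorem exists_extension_lift_elementary {V W U Q : Type*} [AddCommGroup V] [AddCommGroup W]
    [AddCommGroup U] [AddCommGroup Q] (hV : ∀ x : V, p • x = 0) (hW : ∀ x : W, p • x = 0)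
    (hU : ∀ x : U, p • x = 0) (hQ : ∀ x : Q, p • x = 0)
    (j : U →+ V) (hj : Function.Injective j) (π : W →+ Q) (hπ : Function.Surjective π)
    (ψ : U →+ Q) : ∃ δ : V →+ W, (π.comp δ).comp j = ψ := by
  have _ : Module (ZMod p) V := AddCommGroup.zmodModule hV
  have _ : Module (ZMod p) W := AddCommGroup.zmodModule hW
  have _ : Module (ZMod p) U := AddCommGroup.zmodModule hU
  have _ : Module (ZMod p) Q := AddCommGroup.zmodModule hQ
  have hj' : (j.toZModLinearMap p).ker = ⊥ := LinearMap.ker_eq_bot.2 hj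
  have hπ' : (π.toZModLinearMap p).range = ⊤ := LinearMap.range_eq_top.2 hπ
  obtain ⟨r, hr⟩ := LinearMap.exists_leftInverse_of_injective (j.toZModLinearMap p) hj'
  obtain ⟨s, hs⟩ := LinearMap.exists_rightInverse_of_surjective (π.toZModLinearMap p) hπ'
  refine ⟨((s ∘ₗ ψ.toZModLinearMap p) ∘ₗ r).toAddMonoidHom, ?_⟩
  ext x
  have h1 : r (j x) = x := LinearMap.congr_fun hr x
  have h2 : π (s (ψ x)) = ψ x := LinearMap.congr_fun hs (ψ x)
  simp [h1, h2]

end Elementary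

/-! ### Fibre counts, and surjections among perturbations of a linear map -/

theorem card_fiber_addMonoidHom {A B : Type*} [AddGroup A] [AddGroup B] (f : A →+ B)
    (hf : Function.Surjective f) (b : B) : Nat.card {a // f a = b} = Nat.card f.ker := by
  obtain ⟨a₀, rfl⟩ := hf b
  exact Nat.card_congr
    { toFun := fun a => ⟨a.1 - a₀, by rw [AddMonoidHom.mem_ker, map_sub, a.2, sub_self]⟩
      invFun := fun k => ⟨k.1 + a₀, by rw [map_add, k.2, zero_add]⟩
      left_inv := fun a => by simp
      right_inv := fun k => by simp }

theorem card_eq_card_ker_mul {A B : Type*} [AddGroup A] [AddGroup B] (f : A →+ B)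
    (hf : Function.Surjective f) : Nat.card A = Nat.card f.ker * Nat.card B := by
  rw [← f.ker.card_mul_index, AddSubgroup.index_ker, AddMonoidHom.range_eq_top.2 hf,
    AddSubgroup.card_top]

/-- All fibres of f have the same size, so a property has the same density on B as its pullback has
on A. -/
theorem card_subtype_comp_mul {A B : Type*} [AddGroup A] [AddGroup B] [Finite A] [Finite B]
    (f : A →+ B) (hf : Function.Surjective f) (P : B → Prop) :
    Nat.card {a // P (f a)} * Nat.card B = Nat.card {b // P b} * Nat.card A := by
  have e : {a // P (f a)} ≃ Σ b : {b // P b}, {a // f a = b.1} :=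
    { toFun := fun a => ⟨⟨f a.1, a.2⟩, ⟨a.1, rfl⟩⟩
      invFun := fun x => ⟨x.2.1, by rw [x.2.2]; exact x.1.2⟩
      left_inv := fun a => rfl
      right_inv := fun ⟨⟨b, hb⟩, ⟨a, ha⟩⟩ => by
        dsimp at ha
        subst ha
        rfl }
  have := Fintype.ofFinite {b // P b}
  rw [Nat.card_congr e, Nat.card_sigma, card_eq_card_ker_mul f hf,
    Finset.sum_congr rfl fun b _ => card_fiber_addMonoidHom f hf b.1, Finset.sum_const,
    Finset.card_univ, ← Nat.card_eq_fintype_card, smul_eq_mul]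
  ring

theorem surjective_iff_ker_subset_image {V Y R : Type*} [AddCommGroup V] [AddCommGroup Y]
    [AddCommGroup R] (f : V →+ Y) (σ : Y →+ R) (h : Function.Surjective (σ.comp f)) :
    Function.Surjective f ↔ ∀ y, σ y = 0 → ∃ u, σ (f u) = 0 ∧ f u = y := by
  constructor
  · intro hf y hy
    obtain ⟨u, rfl⟩ := hf y
    exact ⟨u, hy, rfl⟩
  · intro H y
    obtain ⟨v, hv⟩ := h (σ y)
    obtain ⟨u, -, hu⟩ := H (y - f v) (by rw [map_sub, sub_eq_zero]; exact hv.symm)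
    exact ⟨u + v, by rw [map_add, hu, sub_add_cancel]⟩

theorem card_eq_pow_sub {p m c d : ℕ} (hp : p.Prime) (h : p ^ m = c * p ^ d) :
    d ≤ m ∧ c = p ^ (m - d) := by
  have hd : d ≤ m := (Nat.pow_dvd_pow_iff_le_right hp.one_lt).1 (Dvd.intro_left c h.symm)
  refine ⟨hd, Nat.eq_of_mul_eq_mul_right (pow_pos hp.pos d) ?_⟩
  rw [← h, ← pow_add, Nat.sub_add_cancel hd]

/-- Adding τδ does not change the composite with σ, so f + τδ is onto exactly when it maps U =
ker(σf) onto ker σ. The restrictions to U are φ + Φδ with Φ a surjective homomorphism. The density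
of good δ is thus that of surjections among all maps between spaces of dimensions a - c and b - c.
-/
theorem card_surjective_add_comp {p : ℕ} [hp : Fact p.Prime] {V W Y R : Type*} [AddCommGroup V]
    [AddCommGroup W] [AddCommGroup Y] [AddCommGroup R] [Finite V] [Finite W] [Finite Y]
    (hV : ∀ x : V, p • x = 0) (hW : ∀ x : W, p • x = 0) (hY : ∀ x : Y, p • x = 0)
    (f : V →+ Y) (σ : Y →+ R) (τ : W →+ Y) (hσf : Function.Surjective (σ.comp f))
    (hτ : τ.range = σ.ker) {a b c : ℕ} (ha : Nat.card V = p ^ a) (hbW : Nat.card W = p ^ b)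
    (hb : Nat.card Y = p ^ b) (hc : Nat.card R = p ^ c) :
    (Nat.card {δ : V →+ W // Function.Surjective (f + τ.comp δ)} : ℝ) =
      (p : ℝ) ^ (a * b) * (qPoch (p : ℝ)⁻¹ (p : ℝ)⁻¹ (a - c) * invPoch (p : ℝ)⁻¹ a b) := by
  have hp0 : (p : ℝ) ≠ 0 := Nat.cast_ne_zero.2 hp.out.ne_zero
  let U := (σ.comp f).ker
  have hστ : ∀ w, σ (τ w) = 0 := fun w => by
    have : τ w ∈ σ.ker := hτ ▸ ⟨w, rfl⟩
    exact this
  let φ : U →+ σ.ker := (f.comp U.subtype).codRestrict σ.ker fun u => u.2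
  let π : W →+ σ.ker := τ.codRestrict σ.ker hστ
  have hπ : Function.Surjective π := by
    rintro ⟨y, hy⟩
    obtain ⟨w, rfl⟩ := hτ.symm ▸ hy
    exact ⟨w, rfl⟩
  have hU : ∀ x : U, p • x = 0 := fun x => Subtype.ext (hV x.1)
  have hQ : ∀ x : σ.ker, p • x = 0 := fun x => Subtype.ext (hY x.1)
  obtain ⟨hca, hcU⟩ := card_eq_pow_sub (c := Nat.card U) (d := c) hp.out
    (by rw [← ha, ← hc]; exact card_eq_card_ker_mul (σ.comp f) hσf)
  obtain ⟨hcb, hcQ⟩ := card_eq_pow_sub (c := Nat.card σ.ker) (d := c) hp.out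
    (by rw [← hb, ← hc]; exact card_eq_card_ker_mul σ fun r =>
      let ⟨v, hv⟩ := hσf r; ⟨f v, hv⟩)
  let Φ : (V →+ W) →+ (U →+ σ.ker) :=
    { toFun := fun δ => (π.comp δ).comp U.subtype
      map_zero' := by ext; simp
      map_add' := fun δ ε => by ext; simp }
  have hΦ : Function.Surjective Φ := fun ψ =>
    exists_extension_lift_elementary hV hW hU hQ U.subtype Subtype.val_injective π hπ ψ
  have hiff : ∀ δ : V →+ W, Function.Surjective (f + τ.comp δ) ↔
      Function.Surjective (φ + Φ δ) := by
    intro δ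
    have hcomp : ∀ v, σ ((f + τ.comp δ) v) = σ (f v) := fun v => by simp [hστ]
    rw [surjective_iff_ker_subset_image _ σ fun r => by
      obtain ⟨v, hv⟩ := hσf r
      exact ⟨v, (hcomp v).trans hv⟩]
    constructor
    · rintro H ⟨y, hy⟩
      obtain ⟨u, hu, rfl⟩ := H y hy
      exact ⟨⟨u, (hcomp u).symm.trans hu⟩, rfl⟩
    · intro H y hy
      obtain ⟨u, hu⟩ := H ⟨y, hy⟩
      exact ⟨u.1, (hcomp u.1).trans u.2, congrArg Subtype.val hu⟩
  have e : {ψ : U →+ σ.ker // Function.Surjective (φ + ψ)} ≃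
      {ψ : U →+ σ.ker // Function.Surjective ψ} :=
    (Equiv.addLeft φ).subtypeEquiv fun ψ => Iff.rfl
  have : Finite (V →+ W) := DFunLike.finite _
  have : Finite (U →+ σ.ker) := DFunLike.finite _
  have key := card_subtype_comp_mul Φ hΦ fun ψ => Function.Surjective (φ + ψ)
  rw [Nat.card_congr e, ← Nat.card_congr (Equiv.subtypeEquivRight hiff),
    card_addMonoidHom_elementary p hU hQ hcU hcQ, card_addMonoidHom_elementary p hV hW ha hbW]
    at key
  have key' := congrArg (Nat.cast (R := ℝ)) key
  push_cast at key'
  rw [card_surjective_elementary p hU hQ hcU hcQ] at key'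
  -- `invPoch` depends only on the difference of its arguments and their order; no truncation
  -- occurs, as c ≤ a and c ≤ b.
  have hinv : invPoch (p : ℝ)⁻¹ (a - c) (b - c) = invPoch (p : ℝ)⁻¹ a b := by
    unfold invPoch
    rw [show a - c - (b - c) = a - b by omega]
    exact if_congr (by omega) rfl rfl
  rw [hinv] at key'
  have hne := pow_ne_zero ((a - c) * (b - c)) hp0
  apply mul_right_cancel₀ hne
  rw [key']
  ring

/-! ### Surjections A → B with prescribed restriction pA → pB -/

/-- The subgroup `n A` of an abelian group `A`. -/
def multiples (n : ℕ) (A : Type*) [AddCommGroup A] : AddSubgroup A :=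
  (nsmulAddMonoidHom n : A →+ A).range

/-- Multiplication by `n` as a homomorphism `A → n A`. -/
def toMultiples (n : ℕ) (A : Type*) [AddCommGroup A] : A →+ multiples n A :=
  (nsmulAddMonoidHom n : A →+ A).rangeRestrict

theorem toMultiples_surjective (n : ℕ) (A : Type*) [AddCommGroup A] :
    Function.Surjective (toMultiples n A) :=
  AddMonoidHom.rangeRestrict_surjective _

@[simp]
theorem coe_toMultiples (n : ℕ) {A : Type*} [AddCommGroup A] (x : A) :
    (toMultiples n A x : A) = n • x := rfl

theorem mem_multiples {n : ℕ} {A : Type*} [AddCommGroup A] {x : A} :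
    x ∈ multiples n A ↔ ∃ y, n • y = x := Iff.rfl

theorem nsmul_quotient_multiples (n : ℕ) {A : Type*} [AddCommGroup A] (x : A ⧸ multiples n A) :
    n • x = 0 := by
  obtain ⟨x, rfl⟩ := QuotientAddGroup.mk_surjective x
  rw [← QuotientAddGroup.mk_nsmul, QuotientAddGroup.eq_zero_iff]
  exact ⟨x, rfl⟩

/-- Split A into cyclic groups with generators x_i of order n_i and choose y_i with p y_i = h(p
x_i). Since p divides n_i, also n_i y_i = h(n_i x_i) = 0, so x_i ↦ y_i defines a homomorphism. -/
theorem exists_extension_of_multiples {p L : ℕ} (hp : p.Prime) {A B : Type*} [AddCommGroup A]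
    [AddCommGroup B] [Finite A] (hA : ∀ x : A, p ^ L • x = 0)
    (h : multiples p A →+ multiples p B) :
    ∃ g : A →+ B, ∀ x, g (p • x) = h (toMultiples p A x) := by
  obtain ⟨ι, _, n, hn, ⟨e⟩⟩ := AddCommGroup.equiv_directSum_zmod_of_finite' A
  classical
  let x : ι → A := fun i => e.symm (DirectSum.of _ i 1)
  choose y hy using fun i => mem_multiples.1 (h (toMultiples p A (x i))).2
  have hnx : ∀ i, n i • x i = 0 := fun i => by
    rw [← map_nsmul, ← map_nsmul, nsmul_one, ZMod.natCast_self, map_zero, map_zero]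
  have hpn : ∀ i, p ∣ n i := fun i => by
    have h1 : p ^ L • x i = 0 := hA _
    rw [← map_nsmul, ← map_nsmul, nsmul_one, EmbeddingLike.map_eq_zero_iff] at h1
    have h2 : ((p ^ L : ℕ) : ZMod (n i)) = 0 := by
      have := DirectSum.of_injective (β := fun i => ZMod (n i)) i
      exact this (h1.trans (map_zero _).symm)
    rw [ZMod.natCast_eq_zero_iff, Nat.dvd_prime_pow hp] at h2
    obtain ⟨k, -, hk⟩ := h2
    rw [hk]
    -- The decomposition has only nontrivial summands, so the exponent k is not 0.
    refine dvd_pow_self p fun hk0 => ?_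
    have := hn i
    rw [hk, hk0, pow_zero] at this
    exact this.false
  have hny : ∀ i, (n i : ℤ) • y i = 0 := fun i => by
    obtain ⟨m, hm⟩ := hpn i
    have : m • toMultiples p A (x i) = 0 := by
      rw [← map_nsmul]
      apply Subtype.ext
      rw [coe_toMultiples, ← mul_nsmul', ← hm, hnx]
      rfl
    rw [natCast_zsmul, hm, mul_comm, mul_nsmul', hy, ← AddSubgroup.coe_nsmul, ← map_nsmul, this,
      map_zero]
    rfl
  let f : ∀ i, ZMod (n i) →+ B := fun i => ZMod.lift (n i) ⟨zmultiplesHom B (y i), hny i⟩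
  have hf : ∀ i (z : ℤ), f i z = z • y i := fun i z => by
    simp [f, ZMod.lift_coe]
  let g : A →+ B := (DirectSum.toAddMonoid f).comp e.toAddMonoidHom
  refine ⟨g, fun a => ?_⟩
  have : (g.comp (nsmulAddMonoidHom p)).comp e.symm.toAddMonoidHom =
      (((multiples p B).subtype.comp h).comp (toMultiples p A)).comp e.symm.toAddMonoidHom := by
    refine DirectSum.addHom_ext fun i k => ?_
    obtain ⟨z, rfl⟩ := ZMod.intCast_surjective k
    have hz : (DirectSum.of (fun i => ZMod (n i)) i) (z : ZMod (n i)) =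
        z • DirectSum.of (fun i => ZMod (n i)) i 1 := by
      rw [← map_zsmul, zsmul_one]
    rw [hz, map_zsmul, map_zsmul]
    congr 1
    have h1 : f i 1 = y i := by simpa using hf i 1
    simpa [g, h1] using hy i
  simpa [g] using DFunLike.congr_fun this (e a)

theorem card_ker_nsmul (n : ℕ) (B : Type*) [AddCommGroup B] [Finite B] :
    Nat.card (nsmulAddMonoidHom n : B →+ B).ker = Nat.card (B ⧸ multiples n B) := by
  have h1 := card_eq_card_ker_mul (toMultiples n B) (toMultiples_surjective n B)
  have h2 := AddSubgroup.card_eq_card_quotient_mul_card_addSubgroup (multiples n B)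
  have h3 : (toMultiples n B).ker = (nsmulAddMonoidHom n : B →+ B).ker :=
    AddMonoidHom.ker_rangeRestrict _
  rw [h3] at h1
  exact Nat.eq_of_mul_eq_mul_right Nat.card_pos (h1.symm.trans h2)

/-- The extensions of h form a torsor under Hom(A/pA, B[p]): a difference of two of them is killed
by p and so factors through A/pA. `card_surjective_add_comp` then applies to f = g₀ mod p, to
multiplication by p as σ : B/pB → pB/p²B, and to τ : B[p] → B/pB. -/
theorem card_surjective_extensions {p L : ℕ} [hp : Fact p.Prime] {A B : Type*} [AddCommGroup A]
    [AddCommGroup B] [Finite A] [Finite B] (hA : ∀ x : A, p ^ L • x = 0)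
    (h : multiples p A →+ multiples p B) (hh : Function.Surjective h) {a b c : ℕ}
    (ha : Nat.card (A ⧸ multiples p A) = p ^ a) (hb : Nat.card (B ⧸ multiples p B) = p ^ b)
    (hc : Nat.card (multiples p B ⧸ multiples p (multiples p B)) = p ^ c) :
    (Nat.card {g : A →+ B // Function.Surjective g ∧
        ∀ x, toMultiples p B (g x) = h (toMultiples p A x)} : ℝ) =
      (p : ℝ) ^ (a * b) * (qPoch (p : ℝ)⁻¹ (p : ℝ)⁻¹ (a - c) * invPoch (p : ℝ)⁻¹ a b) := by
  obtain ⟨g₀, hg₀⟩ : ∃ g : A →+ B, ∀ x, toMultiples p B (g x) = h (toMultiples p A x) := by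
    obtain ⟨g, hg⟩ := exists_extension_of_multiples hp.out hA h
    exact ⟨g, fun x => Subtype.ext (by rw [← hg, map_nsmul, coe_toMultiples])⟩
  let W := (nsmulAddMonoidHom p : B →+ B).ker
  let f : A ⧸ multiples p A →+ B ⧸ multiples p B :=
    QuotientAddGroup.map _ _ g₀ (by rintro _ ⟨y, rfl⟩; exact ⟨g₀ y, by simp⟩)
  let σ : B ⧸ multiples p B →+ multiples p B ⧸ multiples p (multiples p B) :=
    QuotientAddGroup.map _ _ (toMultiples p B)
      (by rintro _ ⟨y, rfl⟩; exact ⟨toMultiples p B y, by simp⟩)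
  let τ : W →+ B ⧸ multiples p B := (QuotientAddGroup.mk' _).comp W.subtype
  have hσf : Function.Surjective (σ.comp f) := by
    intro r
    obtain ⟨z, rfl⟩ := QuotientAddGroup.mk_surjective r
    obtain ⟨w, rfl⟩ := hh z
    obtain ⟨x, rfl⟩ := toMultiples_surjective p A w
    exact ⟨(x : A ⧸ multiples p A), by rw [← hg₀]; rfl⟩
  have hτ : τ.range = σ.ker := by
    ext y
    obtain ⟨x, rfl⟩ := QuotientAddGroup.mk_surjective y
    have hσ : σ x = (toMultiples p B x : multiples p B ⧸ multiples p (multiples p B)) := rfl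
    rw [AddMonoidHom.mem_ker, hσ, QuotientAddGroup.eq_zero_iff, mem_multiples]
    constructor
    · rintro ⟨w, hw⟩
      have hw' : -(w : B) + x ∈ multiples p B := QuotientAddGroup.eq.1 hw
      refine ⟨⟨_, hw'⟩, Subtype.ext ?_⟩
      have : p • (w : B) = 0 := w.2
      simp [this]
    · rintro ⟨z, hz⟩
      have hz' : p • (z : B) = p • x := congrArg Subtype.val hz
      refine ⟨⟨x - z, ?_⟩, QuotientAddGroup.eq.2 ?_⟩
      · simp [W, AddMonoidHom.mem_ker, smul_sub, hz']
      · simp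
  have hW : ∀ x : W, p • x = 0 := fun x => Subtype.ext x.2
  -- As h is onto, the image of g contains pB, so surjectivity can be tested modulo p.
  have hsurj : ∀ g : A →+ B, (∀ x, toMultiples p B (g x) = h (toMultiples p A x)) →
      ∀ F : A ⧸ multiples p A →+ B ⧸ multiples p B, (∀ x : A, F x = (g x : B ⧸ multiples p B)) →
        (Function.Surjective g ↔ Function.Surjective F) := by
    intro g hg F hF
    constructor
    · intro H y
      obtain ⟨y, rfl⟩ := QuotientAddGroup.mk_surjective y
      obtain ⟨x, rfl⟩ := H y
      exact ⟨x, hF x⟩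
    · intro H y
      obtain ⟨v, hv⟩ := H y
      obtain ⟨x, rfl⟩ := QuotientAddGroup.mk_surjective v
      rw [hF] at hv
      obtain ⟨w, hw⟩ := hh ⟨_, QuotientAddGroup.eq.1 hv⟩
      obtain ⟨x', rfl⟩ := toMultiples_surjective p A w
      refine ⟨x + p • x', ?_⟩
      have : p • g x' = -g x + y := by
        rw [← hg] at hw
        exact congrArg Subtype.val hw
      rw [map_add, map_nsmul, this, add_neg_cancel_left]
  have hmk : ∀ (δ : A ⧸ multiples p A →+ W) (x : A), (f + τ.comp δ) x =
      ((g₀ + W.subtype.comp (δ.comp (QuotientAddGroup.mk' (multiples p A)))) x :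
        B ⧸ multiples p B) := fun δ x => rfl
  have hext : ∀ δ : A ⧸ multiples p A →+ W, ∀ x, toMultiples p B
      ((g₀ + W.subtype.comp (δ.comp (QuotientAddGroup.mk' (multiples p A)))) x) =
        h (toMultiples p A x) := by
    intro δ x
    have : toMultiples p B (δ x : W) = 0 := Subtype.ext (δ x).2
    rw [← hg₀, AddMonoidHom.add_apply, map_add]
    exact (congrArg _ this).trans (add_zero _)
  have e : {δ : A ⧸ multiples p A →+ W // Function.Surjective (f + τ.comp δ)} ≃
      {g : A →+ B // Function.Surjective g ∧
        ∀ x, toMultiples p B (g x) = h (toMultiples p A x)} :=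
    { toFun := fun δ => ⟨g₀ + W.subtype.comp (δ.1.comp (QuotientAddGroup.mk' (multiples p A))),
        (hsurj _ (hext δ.1) _ (hmk δ.1)).2 δ.2, hext δ.1⟩
      invFun := fun g =>
        let δ₀ : A →+ W := (g.1 - g₀).codRestrict W fun x => by
          have := congrArg Subtype.val ((g.2.2 x).trans (hg₀ x).symm)
          rw [coe_toMultiples, coe_toMultiples] at this
          simp [W, AddMonoidHom.mem_ker, smul_sub, this]
        let δ : A ⧸ multiples p A →+ W := QuotientAddGroup.lift _ δ₀ (by
          rintro _ ⟨y, rfl⟩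
          exact (map_nsmul δ₀ p y).trans (hW _))
        ⟨δ, (hsurj g.1 g.2.2 _ fun x => (hmk δ x).trans (congrArg _ (add_sub_cancel (g₀ x) (g.1 x)))).1 g.2.1⟩
      left_inv := fun δ => by
        apply Subtype.ext
        apply QuotientAddGroup.addMonoidHom_ext
        ext x
        simp
      right_inv := fun g => by
        ext x
        exact add_sub_cancel (g₀ x) (g.1 x) }
  rw [← Nat.card_congr e]
  exact card_surjective_add_comp (nsmul_quotient_multiples p) hW (nsmul_quotient_multiples p)
    f σ τ hσf hτ ha ((card_ker_nsmul p B).trans hb) hb hc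

/-! ### Ranks and the product formula for #Sur -/

/-- The abelian group `A` has `p`-ranks `a i = dim p^i A / p^(i+1) A`. -/
def HasRanks (p : ℕ) (A : Type*) [AddCommGroup A] (a : ℕ → ℕ) : Prop :=
  ∀ i, Nat.card (multiples (p ^ i) A) = p ^ a i * Nat.card (multiples (p ^ (i + 1)) A)

theorem card_multiples_multiples (m n : ℕ) (A : Type*) [AddCommGroup A] :
    Nat.card (multiples m (multiples n A)) = Nat.card (multiples (n * m) A) := by
  rw [← AddSubgroup.card_map_of_injective (multiples n A).subtype_injective]
  congr 2
  ext x
  simp only [AddSubgroup.mem_map, mem_multiples]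
  constructor
  · rintro ⟨_, ⟨⟨_, y, rfl⟩, rfl⟩, rfl⟩
    exact ⟨y, by simp [mul_nsmul]⟩
  · rintro ⟨y, rfl⟩
    exact ⟨_, ⟨⟨n • y, y, rfl⟩, rfl⟩, by simp [mul_nsmul]⟩

theorem HasRanks.multiples {p : ℕ} {A : Type*} [AddCommGroup A] {a : ℕ → ℕ}
    (h : HasRanks p A a) : HasRanks p (multiples p A) fun i => a (i + 1) := fun i => by
  rw [card_multiples_multiples, card_multiples_multiples, ← pow_succ', ← pow_succ', h (i + 1)]

theorem HasRanks.card_quotient {p : ℕ} {A : Type*} [AddCommGroup A] [Finite A] {a : ℕ → ℕ}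
    (h : HasRanks p A a) : Nat.card (A ⧸ _root_.multiples p A) = p ^ a 0 := by
  have h1 := h 0
  have h2 := AddSubgroup.card_eq_card_quotient_mul_card_addSubgroup (_root_.multiples p A)
  have h3 : Nat.card (_root_.multiples (p ^ 0) A) = Nat.card A := by
    rw [← AddSubgroup.card_top (G := A)]
    congr 2
    ext x
    simp [mem_multiples]
  rw [zero_add, pow_one, h3] at h1
  exact Nat.eq_of_mul_eq_mul_right Nat.card_pos (h2.symm.trans h1)

/-- Induction on the exponent: passing to pA → pB shifts the ranks by one, and the number of
surjections over each restriction is the same, giving the factor i = 0. -/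
theorem card_surjective_eq_prod {p : ℕ} [hp : Fact p.Prime] (L : ℕ) {A B : Type*} [AddCommGroup A]
    [AddCommGroup B] [Finite A] [Finite B] (hA : ∀ x : A, p ^ L • x = 0)
    (hB : ∀ x : B, p ^ L • x = 0) {a b : ℕ → ℕ} (ha : HasRanks p A a) (hb : HasRanks p B b) :
    (Nat.card {f : A →+ B // Function.Surjective f} : ℝ) =
      ∏ i ∈ Finset.range L, ((p : ℝ) ^ (a i * b i) *
        (qPoch (p : ℝ)⁻¹ (p : ℝ)⁻¹ (a i - b (i + 1)) * invPoch (p : ℝ)⁻¹ (a i) (b i))) := by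
  induction L generalizing A B a b with
  | zero =>
    have : Subsingleton A := ⟨fun x y => by simpa using (hA x).trans (hA y).symm⟩
    have : Subsingleton B := ⟨fun x y => by simpa using (hB x).trans (hB y).symm⟩
    have : Unique {f : A →+ B // Function.Surjective f} :=
      { default := ⟨0, fun y => ⟨0, Subsingleton.elim _ _⟩⟩
        uniq := fun f => by ext x; exact Subsingleton.elim _ _ }
    simp
  | succ L ih =>
    have hA' : ∀ x : multiples p A, p ^ L • x = 0 := by
      rintro ⟨_, y, rfl⟩
      exact Subtype.ext (by simpa [pow_succ', mul_nsmul] using hA y)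
    have hB' : ∀ x : multiples p B, p ^ L • x = 0 := by
      rintro ⟨_, y, rfl⟩
      exact Subtype.ext (by simpa [pow_succ', mul_nsmul] using hB y)
    have hmap : ∀ f : A →+ B, multiples p A ≤ (multiples p B).comap f := by
      rintro f _ ⟨y, rfl⟩
      exact ⟨f y, by simp⟩
    let res : {f : A →+ B // Function.Surjective f} →
        {h : multiples p A →+ multiples p B // Function.Surjective h} := fun f =>
      ⟨(f.1.comp (multiples p A).subtype).codRestrict _ fun x => hmap f.1 x.2, by
        rintro ⟨_, y, rfl⟩
        obtain ⟨x, rfl⟩ := f.2 y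
        exact ⟨toMultiples p A x, Subtype.ext (map_nsmul f.1 p x)⟩⟩
    have e : ∀ h : {h : multiples p A →+ multiples p B // Function.Surjective h},
        {f // res f = h} ≃ {g : A →+ B // Function.Surjective g ∧
          ∀ x, toMultiples p B (g x) = h.1 (toMultiples p A x)} := fun h =>
      { toFun := fun f => ⟨f.1.1, f.1.2, fun x => by
          have := DFunLike.congr_fun (congrArg Subtype.val f.2) (toMultiples p A x)
          rw [← this]
          exact Subtype.ext (map_nsmul f.1.1 p x).symm⟩
        invFun := fun g => ⟨⟨g.1, g.2.1⟩, by
          apply Subtype.ext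
          ext x
          obtain ⟨x, rfl⟩ := toMultiples_surjective p A x
          rw [← g.2.2 x]
          exact map_nsmul g.1 p x⟩
        left_inv := fun f => rfl
        right_inv := fun g => rfl }
    have : Finite (A →+ B) := DFunLike.finite _
    have : Finite (multiples p A →+ multiples p B) := DFunLike.finite _
    have := Fintype.ofFinite {h : multiples p A →+ multiples p B // Function.Surjective h}
    rw [Nat.card_congr (Equiv.sigmaFiberEquiv res).symm, Nat.card_sigma, Nat.cast_sum,
      Finset.sum_congr rfl fun h _ => by
        rw [Nat.card_congr (e h), card_surjective_extensions hA h.1 h.2 ha.card_quotient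
          hb.card_quotient hb.multiples.card_quotient],
      Finset.sum_const, Finset.card_univ, ← Nat.card_eq_fintype_card, nsmul_eq_mul,
      ih hA' hB' ha.multiples hb.multiples, Finset.prod_range_succ']

/-! ### Young diagrams described by their columns -/

/-- The Young diagram with prescribed column lengths. -/
def youngOfColLen (b : ℕ → ℕ) (hb : Antitone b) (L : ℕ) : YoungDiagram where
  cells := (Finset.range (b 0) ×ˢ Finset.range L).filter fun x => x.1 < b x.2
  isLowerSet := by
    rintro ⟨i, j⟩ ⟨i', j'⟩ ⟨hi, hj⟩ h
    simp only [Finset.coe_filter, Finset.mem_product, Finset.mem_range, Set.mem_ofPred_eq] at h hi hj ⊢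
    have := hb hj
    omega

theorem colLen_youngOfColLen {b : ℕ → ℕ} (hb : Antitone b) {L : ℕ} (hL : ∀ i, L ≤ i → b i = 0)
    (j : ℕ) : (youngOfColLen b hb L).colLen j = b j := by
  refine eq_of_forall_lt_iff fun i => ?_
  rw [← YoungDiagram.mem_iff_lt_colLen, ← YoungDiagram.mem_cells]
  simp only [youngOfColLen, Finset.mem_filter, Finset.mem_product, Finset.mem_range]
  refine ⟨fun h => h.2, fun h => ⟨⟨h.trans_le (hb (Nat.zero_le j)), ?_⟩, h⟩⟩
  by_contra hj
  rw [hL j (not_lt.1 hj)] at h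
  omega

theorem YoungDiagram.ext_colLen {μ ν : YoungDiagram} (h : ∀ i, μ.colLen i = ν.colLen i) :
    μ = ν := by
  ext ⟨i, j⟩
  rw [YoungDiagram.mem_cells, YoungDiagram.mem_cells, YoungDiagram.mem_iff_lt_colLen,
    YoungDiagram.mem_iff_lt_colLen, h]

theorem YoungDiagram.lt_colLen_iff_lt_rowLen {μ : YoungDiagram} {i j : ℕ} :
    i < μ.colLen j ↔ j < μ.rowLen i :=
  YoungDiagram.mem_iff_lt_colLen.symm.trans YoungDiagram.mem_iff_lt_rowLen

theorem YoungDiagram.colLen_eq_zero {μ : YoungDiagram} {i : ℕ} (h : μ.rowLen 0 ≤ i) :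
    μ.colLen i = 0 := by
  by_contra hne
  have := YoungDiagram.lt_colLen_iff_lt_rowLen.1 (Nat.pos_of_ne_zero hne)
  omega

theorem sum_cells_fst (μ : YoungDiagram) (f : ℕ → ℕ) :
    ∑ x ∈ μ.cells, f x.1 = ∑ i ∈ Finset.range (μ.colLen 0), f i * μ.rowLen i := by
  rw [← Finset.sum_fiberwise_of_maps_to (g := Prod.fst) (t := Finset.range (μ.colLen 0))]
  · refine Finset.sum_congr rfl fun i _ => ?_
    have : ∀ x ∈ μ.cells.filter (fun x => x.1 = i), f x.1 = f i := fun x hx => by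
      rw [(Finset.mem_filter.1 hx).2]
    rw [Finset.sum_congr rfl this, Finset.sum_const, smul_eq_mul, mul_comm,
      YoungDiagram.rowLen_eq_card]
    rfl
  · rintro ⟨i, j⟩ hx
    rw [Finset.mem_range, ← YoungDiagram.mem_iff_lt_colLen]
    exact μ.up_left_mem le_rfl (Nat.zero_le j) hx

theorem sum_cells_eq_sum_colLen (μ : YoungDiagram) (f : ℕ → ℕ) {L : ℕ} (hL : μ.rowLen 0 ≤ L) :
    ∑ x ∈ μ.cells, f x.1 = ∑ j ∈ Finset.range L, ∑ i ∈ Finset.range (μ.colLen j), f i := by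
  rw [← Finset.sum_fiberwise_of_maps_to (g := Prod.snd) (t := Finset.range L)]
  · refine Finset.sum_congr rfl fun j _ => ?_
    change ∑ x ∈ μ.col j, f x.1 = _
    rw [YoungDiagram.col_eq_prod, Finset.sum_product]
    simp
  · rintro ⟨i, j⟩ hx
    rw [Finset.mem_range]
    refine lt_of_lt_of_le ?_ hL
    rw [← YoungDiagram.mem_iff_lt_rowLen]
    exact μ.up_left_mem (Nat.zero_le i) le_rfl hx

theorem card_eq_sum_colLen (μ : YoungDiagram) {L : ℕ} (hL : μ.rowLen 0 ≤ L) :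
    μ.card = ∑ j ∈ Finset.range L, μ.colLen j := by
  have := sum_cells_eq_sum_colLen μ (fun _ => 1) hL
  simpa [YoungDiagram.card] using this

/-- Sum the row index over all cells, by rows and by columns; a column of length k contributes 0 + ⋯
+ (k - 1). -/
theorem partitionN_eq_sum_choose (μ : YoungDiagram) {L : ℕ} (hL : μ.rowLen 0 ≤ L) :
    partitionN μ = ∑ j ∈ Finset.range L, (μ.colLen j).choose 2 := by
  have h := sum_cells_eq_sum_colLen μ id hL
  rw [sum_cells_fst] at h
  simpa [partitionN, Finset.sum_range_id, Nat.choose_two_right] using h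

/-! ### The groups G_λ and the classification of finite abelian p-groups -/

section PGroup

variable {p : ℕ} [hp : Fact p.Prime]

theorem card_multiples_zmod (i r : ℕ) :
    Nat.card (multiples (p ^ i) (ZMod (p ^ r))) = p ^ (r - i) := by
  have h : multiples (p ^ i) (ZMod (p ^ r)) = AddSubgroup.zmultiples ((p ^ i : ℕ) : ZMod (p ^ r)) := by
    ext x
    rw [mem_multiples, AddSubgroup.mem_zmultiples_iff]
    constructor
    · rintro ⟨y, rfl⟩
      obtain ⟨z, rfl⟩ := ZMod.intCast_surjective y
      exact ⟨z, by simp [mul_comm]⟩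
    · rintro ⟨z, rfl⟩
      exact ⟨z, by simp [mul_comm]⟩
  rw [h, Nat.card_zmultiples, ZMod.addOrderOf_coe _ (pow_ne_zero r hp.out.ne_zero)]
  rcases le_total i r with hir | hir
  · rw [Nat.gcd_eq_right (pow_dvd_pow p hir), Nat.pow_div hir hp.out.pos]
  · rw [Nat.gcd_eq_left (pow_dvd_pow p hir), Nat.div_self (pow_pos hp.out.pos r),
      Nat.sub_eq_zero_of_le hir, pow_zero]

theorem card_multiples_pi {ι : Type*} [Fintype ι] (n : ℕ) (A : ι → Type*)
    [∀ i, AddCommGroup (A i)] :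
    Nat.card (multiples n (∀ i, A i)) = ∏ i, Nat.card (multiples n (A i)) := by
  rw [← Nat.card_pi]
  exact Nat.card_congr
    { toFun := fun x i => ⟨x.1 i, by
        obtain ⟨y, hy⟩ := mem_multiples.1 x.2
        exact mem_multiples.2 ⟨y i, congrFun hy i⟩⟩
      invFun := fun x => ⟨fun i => (x i).1, by
        choose y hy using fun i => mem_multiples.1 (x i).2
        exact mem_multiples.2 ⟨y, funext hy⟩⟩
      left_inv := fun x => rfl
      right_inv := fun x => rfl }

/-- The order of p^i G_λ has exponent ∑ max(λ_j - i, 0), which drops by one for each part λ_j > i on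
passing to i + 1. -/
theorem hasRanks_partitionGroup (l : YoungDiagram) :
    HasRanks p (partitionGroup p l).carrier l.colLen := by
  intro i
  have h : ∀ i, Nat.card (multiples (p ^ i) (partitionGroup p l).carrier) =
      p ^ ∑ j : Fin (l.colLen 0), (l.rowLen j - i) := fun i => by
    refine (card_multiples_pi _ _).trans ?_
    simp only [card_multiples_zmod, Finset.prod_pow_eq_pow_sum]
  rw [h, h, ← pow_add]
  congr 1
  have h1 : ∀ j : Fin (l.colLen 0), l.rowLen j - i =
      (if i < l.rowLen j then 1 else 0) + (l.rowLen j - (i + 1)) := fun j => by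
    split_ifs <;> omega
  rw [Finset.sum_congr rfl fun j _ => h1 j, Finset.sum_add_distrib,
    Fin.sum_univ_eq_sum_range (fun j => if i < l.rowLen j then 1 else 0), ← Finset.sum_filter,
    Finset.sum_const, smul_eq_mul, mul_one]
  congr 1
  have : (Finset.range (l.colLen 0)).filter (fun j => i < l.rowLen j) =
      Finset.range (l.colLen i) := by
    ext j
    have := l.colLen_anti 0 i (Nat.zero_le i)
    rw [Finset.mem_filter, Finset.mem_range, Finset.mem_range,
      ← YoungDiagram.lt_colLen_iff_lt_rowLen]
    omega
  rw [this, Finset.card_range]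

theorem pow_nsmul_partitionGroup (l : YoungDiagram) {L : ℕ} (hL : l.rowLen 0 ≤ L)
    (x : (partitionGroup p l).carrier) : p ^ L • x = 0 := by
  funext i
  have h : l.rowLen i ≤ L := (l.rowLen_anti 0 i (Nat.zero_le _)).trans hL
  change p ^ L • x i = 0
  rw [← Nat.sub_add_cancel h, pow_add, mul_nsmul', nsmul_eq_mul (p ^ l.rowLen i),
    ZMod.natCast_self, zero_mul, nsmul_zero]

theorem numSur_partitionGroup (l m : YoungDiagram) {L : ℕ} (hl : l.rowLen 0 ≤ L)
    (hm : m.rowLen 0 ≤ L) :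
    ((partitionGroup p l).numSur (partitionGroup p m) : ℝ) =
      ∏ i ∈ Finset.range L, ((p : ℝ) ^ (l.colLen i * m.colLen i) *
        (qPoch (p : ℝ)⁻¹ (p : ℝ)⁻¹ (l.colLen i - m.colLen (i + 1)) *
          invPoch (p : ℝ)⁻¹ (l.colLen i) (m.colLen i))) :=
  card_surjective_eq_prod L (pow_nsmul_partitionGroup l hl) (pow_nsmul_partitionGroup m hm)
    (hasRanks_partitionGroup l) (hasRanks_partitionGroup m)

theorem partitionGroup_isoClass_injective :
    Function.Injective fun l : YoungDiagram => (partitionGroup p l).isoClass := by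
  intro l m h
  obtain ⟨e⟩ := Quotient.exact h
  have hcard : ∀ n, Nat.card (multiples n (partitionGroup p l).carrier) =
      Nat.card (multiples n (partitionGroup p m).carrier) := fun n =>
    Nat.card_congr
      { toFun := fun x => ⟨e x.1, by
          obtain ⟨y, hy⟩ := mem_multiples.1 x.2
          exact mem_multiples.2 ⟨e y, by rw [← map_nsmul, hy]⟩⟩
        invFun := fun x => ⟨e.symm x.1, by
          obtain ⟨y, hy⟩ := mem_multiples.1 x.2
          exact mem_multiples.2 ⟨e.symm y, by rw [← map_nsmul, hy]⟩⟩
        left_inv := fun x => by simp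
        right_inv := fun x => by simp }
  refine YoungDiagram.ext_colLen fun i => ?_
  have h1 := hasRanks_partitionGroup (p := p) l i
  rw [hcard, hcard, hasRanks_partitionGroup m i] at h1
  exact (Nat.pow_right_injective hp.out.two_le (Nat.eq_of_mul_eq_mul_right Nat.card_pos h1)).symm

theorem exists_partitionGroup_isoClass (C : FinAbPGroupClass p) :
    ∃ l : YoungDiagram, (partitionGroup p l).isoClass = C := by
  obtain ⟨A, rfl⟩ := Quotient.exists_rep C
  obtain ⟨ι, _, n, hn, ⟨e⟩⟩ := AddCommGroup.equiv_directSum_zmod_of_finite' A.carrier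
  classical
  have hk : ∀ i, ∃ k, 0 < k ∧ n i = p ^ k := fun i => by
    obtain ⟨k, hk⟩ := A.isPGroup (Multiplicative.ofAdd (e.symm (DirectSum.of _ i 1)))
    have h1 : p ^ k • e.symm (DirectSum.of (fun i => ZMod (n i)) i 1) = 0 := hk
    rw [← map_nsmul, ← map_nsmul, nsmul_one, EmbeddingLike.map_eq_zero_iff] at h1
    have h2 : ((p ^ k : ℕ) : ZMod (n i)) = 0 :=
      DirectSum.of_injective (β := fun i => ZMod (n i)) i (h1.trans (map_zero _).symm)
    rw [ZMod.natCast_eq_zero_iff, Nat.dvd_prime_pow hp.out] at h2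
    obtain ⟨k, -, hk⟩ := h2
    refine ⟨k, Nat.pos_of_ne_zero ?_, hk⟩
    rintro rfl
    have := hn i
    rw [hk, pow_zero] at this
    exact this.false
  choose k hkpos hk using hk
  let e₀ := (Fintype.equivFin ι).symm
  -- Sorting in the dual order makes the exponents decreasing, as row lengths must be.
  let s := Tuple.sort (OrderDual.toDual ∘ k ∘ e₀)
  have hs : Antitone (k ∘ e₀ ∘ s) := fun i j hij => by
    have := Tuple.monotone_sort (OrderDual.toDual ∘ k ∘ e₀) hij
    exact this
  let r : ℕ → ℕ := fun i => if h : i < Fintype.card ι then k (e₀ (s ⟨i, h⟩)) else 0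
  have hr : Antitone r := fun i j hij => by
    by_cases hj : j < Fintype.card ι
    · have hi := lt_of_le_of_lt hij hj
      simp only [r, hi, hj, dif_pos]
      exact hs (show (⟨i, hi⟩ : Fin _) ≤ ⟨j, hj⟩ from hij)
    · simp [r, hj]
  let l := (youngOfColLen r hr (Fintype.card ι)).transpose
  have hrow : ∀ i, l.rowLen i = r i := fun i => by
    rw [YoungDiagram.rowLen_transpose]
    exact colLen_youngOfColLen hr (fun i hi => by simp [r, not_lt.2 hi]) i
  have hcol : l.colLen 0 = Fintype.card ι := by
    refine eq_of_forall_lt_iff fun i => ?_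
    rw [YoungDiagram.lt_colLen_iff_lt_rowLen, hrow]
    by_cases hi : i < Fintype.card ι
    · simp [r, hi, hkpos]
    · simp [r, hi]
  let ε : Fin (l.colLen 0) ≃ ι := (finCongr hcol).trans (s.trans e₀)
  have hε : ∀ i : Fin (l.colLen 0), p ^ l.rowLen i = n (ε i) := fun i => by
    have hi : (i : ℕ) < Fintype.card ι := hcol ▸ i.2
    rw [hrow, hk]
    simp only [r, hi, dif_pos]
    rfl
  refine ⟨l, Quotient.sound ⟨?_⟩⟩
  exact ((RingEquiv.piCongrRight fun i => ZMod.ringEquivCongr (hε i)).toAddEquiv.trans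
    (RingEquiv.piCongrLeft (fun i => ZMod (n i)) ε).toAddEquiv).trans
      ((DirectSum.addEquivProd _).symm.trans e.symm)

end PGroup

/-! ### The q-binomial theorem and the sum over one column -/

/-- Pascal's rule for q-binomial coefficients, divided by (q;q)_n. -/
theorem qBinomial_recurrence {q : ℝ} (h0 : 0 ≤ q) (h1 : q < 1) {n j : ℕ} (hj : j ≤ n) :
    (1 - q ^ (n + 1)) * ((qPoch q q (j + 1))⁻¹ * invPoch q (n + 1) (j + 1)) =
      (qPoch q q (j + 1))⁻¹ * invPoch q n (j + 1) + q ^ (n - j) * ((qPoch q q j)⁻¹ * invPoch q n j) := by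
  have hP := fun k => (qPoch_self_pos h0 h1 k).ne'
  have hF : ∀ k, 1 - q * q ^ k ≠ 0 := fun k h => by
    have := hP (k + 1)
    rw [qPoch_succ, h, mul_zero] at this
    exact this rfl
  obtain ⟨m, rfl⟩ := Nat.exists_eq_add_of_le hj
  have e1 : invPoch q (j + m + 1) (j + 1) = (qPoch q q m)⁻¹ := by
    rw [invPoch, if_pos (by omega)]; congr 2; omega
  have e2 : invPoch q (j + m) j = (qPoch q q m)⁻¹ := by
    rw [invPoch, if_pos (by omega)]; congr 2; omega
  rw [e1, e2, Nat.add_sub_cancel_left]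
  rcases m with _ | m
  · have e3 : invPoch q (j + 0) (j + 1) = 0 := by simp [invPoch]
    rw [e3, qPoch_succ]
    have := hP j
    have := hF j
    simp [qPoch]
    field_simp
    rw [pow_succ']
  · have e3 : invPoch q (j + (m + 1)) (j + 1) = (qPoch q q m)⁻¹ := by
      rw [invPoch, if_pos (by omega)]; congr 2; omega
    rw [e3, qPoch_succ, qPoch_succ]
    have := hP j
    have := hF j
    have := hP m
    have := hF m
    field_simp
    ring

/-- The `q`-binomial theorem. -/
theorem qBinomial {q : ℝ} (h0 : 0 ≤ q) (h1 : q < 1) (x : ℝ) (n : ℕ) :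
    qPoch q q n * ∑ j ∈ Finset.range (n + 1),
      (-1) ^ j * q ^ (j.choose 2) * x ^ j * ((qPoch q q j)⁻¹ * invPoch q n j) = qPoch x q n := by
  induction n with
  | zero => simp [qPoch, invPoch]
  | succ n ih =>
    rw [qPoch_succ x, ← ih, qPoch_succ, mul_assoc, mul_assoc]
    congr 1
    -- The extra term j = n + 1 is 0 by the convention for `invPoch`, so the two sums can be
    -- compared termwise.
    have hlast : Finset.sum (Finset.range (n + 2)) (fun j =>
        (-1) ^ j * q ^ (j.choose 2) * x ^ j * ((qPoch q q j)⁻¹ * invPoch q n j)) =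
        Finset.sum (Finset.range (n + 1)) (fun j =>
        (-1) ^ j * q ^ (j.choose 2) * x ^ j * ((qPoch q q j)⁻¹ * invPoch q n j)) := by
      rw [Finset.sum_range_succ]
      simp [invPoch]
    rw [mul_sub, mul_one]
    nth_rewrite 1 [← hlast]
    rw [Finset.sum_range_succ', Finset.sum_range_succ' _ (n + 1), mul_add, add_sub_right_comm,
      Finset.mul_sum, Finset.sum_mul, ← Finset.sum_sub_distrib]
    congr 1
    · refine Finset.sum_congr rfl fun j hj => ?_
      have hj' : j ≤ n := Nat.lt_succ_iff.1 (Finset.mem_range.1 hj)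
      have hrec := qBinomial_recurrence h0 h1 hj'
      have hq : q ^ ((j + 1).choose 2) * q ^ (n - j) = q ^ (j.choose 2) * q ^ n := by
        rw [← pow_add, ← pow_add, Nat.choose_succ_succ' j 1, Nat.choose_one_right, one_add_one_eq_two]
        congr 1
        omega
      calc _ = (-1) ^ (j + 1) * q ^ ((j + 1).choose 2) * x ^ (j + 1) *
              ((1 - q ^ (n + 1)) * ((qPoch q q (j + 1))⁻¹ * invPoch q (n + 1) (j + 1))) := by ring
        _ = (-1) ^ (j + 1) * q ^ ((j + 1).choose 2) * x ^ (j + 1) *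
              ((qPoch q q (j + 1))⁻¹ * invPoch q n (j + 1)) +
            (-1) ^ (j + 1) * x ^ (j + 1) * (q ^ ((j + 1).choose 2) * q ^ (n - j)) *
              ((qPoch q q j)⁻¹ * invPoch q n j) := by rw [hrec]; ring
        _ = _ := by rw [hq]; ring
    · have hP := (qPoch_self_pos h0 h1 n).ne'
      have hF : 1 - q * q ^ n ≠ 0 := fun h => by
        have := (qPoch_self_pos h0 h1 (n + 1)).ne'
        rw [qPoch_succ, h, mul_zero] at this
        exact this rfl
      simp only [invPoch, Nat.zero_le, if_true, Nat.sub_zero, qPoch_succ]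
      field_simp

/-- The contribution of one column, of lengths `a`, `b`, `c` in the diagrams `λ`, `μ`, `ν`. -/
def columnTerm (p : ℝ) (a c b : ℕ) : ℝ :=
  (-1) ^ (b - c) * p⁻¹ ^ (c.choose 2 + b.choose 2 + b) * p ^ (a * b) *
    ((qPoch p⁻¹ p⁻¹ (b - c))⁻¹ * invPoch p⁻¹ a b)

theorem columnTerm_self {p : ℝ} (hp : p ≠ 0) (a : ℕ) : columnTerm p a a a = 1 := by
  have h : a.choose 2 + a.choose 2 + a = a * a := by
    rw [Nat.choose_two_right]
    obtain ⟨k, hk⟩ := Nat.even_mul_pred_self a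
    rw [hk, ← two_mul, show (k + k) / 2 = k by omega, two_mul, ← hk]
    cases a with
    | zero => rfl
    | succ a => rw [Nat.add_sub_cancel]; ring
  rw [columnTerm, h, inv_pow]
  simp [invPoch, qPoch, pow_ne_zero _ hp]

/-- With a = c + m + 1 and b = c + j, the sum is, up to a factor free of j, the q-binomial expansion
of (p^m; p⁻¹)_{m+1}, whose last factor is 1 - p^m p^(-m) = 0. -/
theorem sum_columnTerm_eq_zero {p : ℝ} (hp : 1 < p) {a c : ℕ} (h : c < a) :
    ∑ b ∈ Finset.Ico c (a + 1), columnTerm p a c b = 0 := by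
  have hp0 : p ≠ 0 := by positivity
  obtain ⟨m, rfl⟩ : ∃ m, a = c + (m + 1) := ⟨a - c - 1, by omega⟩
  have h0 : (0 : ℝ) ≤ p⁻¹ := by positivity
  have h1 : p⁻¹ < 1 := inv_lt_one_of_one_lt₀ hp
  have hbin := qBinomial h0 h1 (p ^ m) (m + 1)
  have hz : qPoch (p ^ m) p⁻¹ (m + 1) = 0 := by
    rw [qPoch_succ, inv_pow, mul_inv_cancel₀ (pow_ne_zero _ hp0), sub_self, mul_zero]
  rw [hz] at hbin
  have hbin' := (mul_eq_zero.1 hbin).resolve_left (qPoch_self_pos h0 h1 (m + 1)).ne'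
  rw [Finset.sum_Ico_eq_sum_range, show c + (m + 1) + 1 - c = m + 1 + 1 by omega]
  rw [← mul_zero (p⁻¹ ^ (c.choose 2 + c.choose 2 + c) * p ^ ((c + (m + 1)) * c)), ← hbin',
    Finset.mul_sum]
  refine Finset.sum_congr rfl fun j hj => ?_
  have hinv : invPoch p⁻¹ (c + (m + 1)) (c + j) = invPoch p⁻¹ (m + 1) j := by
    unfold invPoch
    rw [Nat.add_sub_add_left]
    exact if_congr (by omega) rfl rfl
  have hch : (c + j).choose 2 = c.choose 2 + j.choose 2 + c * j := by
    clear * -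
    induction j with
    | zero => simp
    | succ j ih =>
      rw [← add_assoc, Nat.choose_succ_succ' _ 1, ih, Nat.choose_succ_succ' j 1,
        Nat.choose_one_right, Nat.choose_one_right]
      ring
  rw [columnTerm, hinv, hch, Nat.add_sub_cancel_left]
  have hpow : p⁻¹ ^ (c.choose 2 + (c.choose 2 + j.choose 2 + c * j) + (c + j)) *
      p ^ ((c + (m + 1)) * (c + j)) = p⁻¹ ^ (c.choose 2 + c.choose 2 + c) *
        p ^ ((c + (m + 1)) * c) * (p⁻¹ ^ j.choose 2 * (p ^ m) ^ j) := by
    rw [show (c + (m + 1)) * (c + j) = (c + (m + 1)) * c + (c * j + (m * j + j)) by ring,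
      show c.choose 2 + (c.choose 2 + j.choose 2 + c * j) + (c + j) =
        c.choose 2 + c.choose 2 + c + (j.choose 2 + (c * j + j)) by ring]
    simp only [pow_add, inv_pow, ← pow_mul]
    field_simp
  calc _ = (-1) ^ j * (p⁻¹ ^ (c.choose 2 + (c.choose 2 + j.choose 2 + c * j) + (c + j)) *
      p ^ ((c + (m + 1)) * (c + j))) * ((qPoch p⁻¹ p⁻¹ j)⁻¹ * invPoch p⁻¹ (m + 1) j) := by ring
    _ = _ := by rw [hpow]; ring

/-- The interaction of a column length `b` of `μ` with the preceding columns of `λ` and `ν`. -/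
def linkTerm (p : ℝ) (a c b : ℕ) : ℝ :=
  qPoch p⁻¹ p⁻¹ (a - b) * (qPoch p⁻¹ p⁻¹ (c - b))⁻¹

theorem linkTerm_self {p : ℝ} (hp : 1 < p) (a b : ℕ) : linkTerm p a a b = 1 :=
  mul_inv_cancel₀ (qPoch_self_pos (by positivity) (inv_lt_one_of_one_lt₀ hp) _).ne'

/-- The contribution of the column `i`, given the column lengths `a` of `λ` and `c` of `ν`. -/
def siteTerm (p : ℝ) (a c : ℕ → ℕ) : ℕ → ℕ → ℝ
  | 0, b => columnTerm p (a 0) (c 0) b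
  | i + 1, b => columnTerm p (a (i + 1)) (c (i + 1)) b * linkTerm p (a i) (c i) b

/-- The possible lengths of the column `i` of `μ` when `μ ⊆ λ` and `μ' ≻ ν'`. -/
def siteRange (a c : ℕ → ℕ) : ℕ → Finset ℕ
  | 0 => Finset.Ico (c 0) (a 0 + 1)
  | i + 1 => Finset.Ico (c (i + 1)) (min (a (i + 1)) (c i) + 1)

theorem sum_siteTerm {p : ℝ} (hp : 1 < p) {a c : ℕ → ℕ} (ha : Antitone a) {i : ℕ}
    (h : ∀ j < i, a j = c j) :
    ∑ b ∈ siteRange a c i, siteTerm p a c i b = if a i = c i then 1 else 0 := by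
  have hsum : ∑ b ∈ siteRange a c i, siteTerm p a c i b =
      ∑ b ∈ Finset.Ico (c i) (a i + 1), columnTerm p (a i) (c i) b := by
    cases i with
    | zero => rfl
    | succ i =>
      have hi := h i (Nat.lt_succ_self i)
      simp only [siteRange, siteTerm, hi, linkTerm_self hp, mul_one]
      rw [← hi, min_eq_left (ha (Nat.le_succ i))]
  rw [hsum]
  split_ifs with heq
  · rw [heq, Nat.Ico_succ_singleton, Finset.sum_singleton, columnTerm_self (by positivity)]
  · rcases lt_or_gt_of_ne heq with hlt | hlt
    · rw [Finset.Ico_eq_empty (by omega), Finset.sum_empty]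
    · exact sum_columnTerm_eq_zero hp hlt

/-- Only the first column with a_i ≠ c_i has to be understood: its sum is 0 and kills the product,
whatever the later factors are. -/
theorem prod_sum_siteTerm {p : ℝ} (hp : 1 < p) {a c : ℕ → ℕ} (ha : Antitone a) (n : ℕ) :
    ∏ i ∈ Finset.range n, ∑ b ∈ siteRange a c i, siteTerm p a c i b =
      if ∀ i < n, a i = c i then 1 else 0 := by
  induction n with
  | zero => simp
  | succ n ih =>
    rw [Finset.prod_range_succ, ih]
    by_cases h : ∀ i < n, a i = c i
    · rw [if_pos h, one_mul, sum_siteTerm hp ha h]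
      exact if_congr ⟨fun h' i hi => (Nat.lt_succ_iff_lt_or_eq.1 hi).elim (h i) fun e => e ▸ h',
        fun h' => h' n (Nat.lt_succ_self n)⟩ rfl rfl
    · rw [if_neg h, zero_mul, if_neg fun h' => h fun i hi => h' i (hi.trans (Nat.lt_succ_self n))]

theorem inversionCoeff_eq_prod {p : ℕ} {m n : YoungDiagram} (h : ConjInterlace m n) {L : ℕ}
    (hm : m.rowLen 0 ≤ L) (hn : n.rowLen 0 ≤ L) :
    inversionCoeff p m n = ∏ i ∈ Finset.range L,
      ((-1) ^ (m.colLen i - n.colLen i) *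
        (p : ℝ)⁻¹ ^ ((n.colLen i).choose 2 + (m.colLen i).choose 2 + m.colLen i) *
        ((qPoch (p : ℝ)⁻¹ (p : ℝ)⁻¹ (m.colLen i - n.colLen i))⁻¹ *
          (qPoch (p : ℝ)⁻¹ (p : ℝ)⁻¹ (n.colLen i - m.colLen (i + 1)))⁻¹)) := by
  have hden : ∏ i ∈ Finset.range (m.rowLen 0),
      (qPoch (p : ℝ)⁻¹ (p : ℝ)⁻¹ (m.colLen i - n.colLen i) *
        qPoch (p : ℝ)⁻¹ (p : ℝ)⁻¹ (n.colLen i - m.colLen (i + 1))) =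
      ∏ i ∈ Finset.range L, (qPoch (p : ℝ)⁻¹ (p : ℝ)⁻¹ (m.colLen i - n.colLen i) *
        qPoch (p : ℝ)⁻¹ (p : ℝ)⁻¹ (n.colLen i - m.colLen (i + 1))) := by
    refine Finset.prod_subset (Finset.range_mono hm) fun i _ hi => ?_
    have hmi : m.colLen i = 0 := YoungDiagram.colLen_eq_zero (by simpa using hi)
    have hni : n.colLen i = 0 := Nat.le_zero.1 (hmi ▸ (h i).1)
    simp [hmi, hni, qPoch]
  rw [inversionCoeff, hden, partitionN_eq_sum_choose m hm, partitionN_eq_sum_choose n hn,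
    card_eq_sum_colLen m hm, card_eq_sum_colLen n hn,
    ← Finset.sum_tsub_distrib _ fun i _ => (h i).1, ← Finset.sum_add_distrib,
    ← Finset.sum_add_distrib, ← Finset.prod_pow_eq_pow_sum, ← Finset.prod_pow_eq_pow_sum,
    ← Finset.prod_mul_distrib, ← Finset.prod_div_distrib]
  refine Finset.prod_congr rfl fun i _ => ?_
  rw [div_eq_mul_inv, mul_inv]

/-! ### The orthogonality relation -/

section Inversion

variable {p : ℕ} [hp : Fact p.Prime]

/-- The factors containing b_{i+1} but indexed by column i form a `linkTerm`, which is moved to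
column i + 1. -/
theorem inversionCoeff_mul_numSur (l : YoungDiagram) {m n : YoungDiagram}
    (h : ConjInterlace m n) {L : ℕ} (hl : l.rowLen 0 ≤ L) (hm : m.rowLen 0 ≤ L)
    (hn : n.rowLen 0 ≤ L) :
    inversionCoeff p m n * ((partitionGroup p l).numSur (partitionGroup p m) : ℝ) =
      ∏ i ∈ Finset.range (L + 1), siteTerm p l.colLen n.colLen i (m.colLen i) := by
  rw [inversionCoeff_eq_prod h (hm.trans (Nat.le_succ L)) (hn.trans (Nat.le_succ L)),
    numSur_partitionGroup l m (hl.trans (Nat.le_succ L)) (hm.trans (Nat.le_succ L)),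
    ← Finset.prod_mul_distrib]
  -- The link leaving the last column is trivial, since λ and ν both have length 0 there.
  have hlink : linkTerm p (l.colLen L) (n.colLen L) (m.colLen (L + 1)) = 1 := by
    rw [YoungDiagram.colLen_eq_zero hl, YoungDiagram.colLen_eq_zero hn]
    exact linkTerm_self (Nat.one_lt_cast.2 hp.out.one_lt) _ _
  calc _ = ∏ i ∈ Finset.range (L + 1), (columnTerm p (l.colLen i) (n.colLen i) (m.colLen i) *
        linkTerm p (l.colLen i) (n.colLen i) (m.colLen (i + 1))) := by
          refine Finset.prod_congr rfl fun i _ => ?_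
          rw [columnTerm, linkTerm]
          ring
    _ = _ := by
      rw [Finset.prod_mul_distrib, Finset.prod_range_succ (fun i => linkTerm _ (l.colLen i) _ _),
        hlink, mul_one, Finset.prod_range_succ', Finset.prod_range_succ' (fun i => siteTerm _ _ _ i _),
        mul_right_comm, ← Finset.prod_mul_distrib]
      rfl

/-- For fixed a and c, the conditions on b decouple into an interval for each b_i, so the admissible
b form a box. -/
theorem mem_siteRange_iff {a b c : ℕ → ℕ} :
    (∀ i, b i ∈ siteRange a c i) ↔
      (∀ i, b i ≤ a i) ∧ ∀ i, c i ≤ b i ∧ b (i + 1) ≤ c i := by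
  constructor
  · intro h
    have h0 := h 0
    have h1 := fun i => h (i + 1)
    simp only [siteRange, Finset.mem_Ico] at h0 h1
    refine ⟨fun i => ?_, fun i => ⟨?_, ?_⟩⟩
    · cases i with
      | zero => omega
      | succ i => have := h1 i; omega
    · cases i with
      | zero => omega
      | succ i => have := h1 i; omega
    · have := h1 i
      omega
  · rintro ⟨h1, h2⟩ i
    cases i with
    | zero =>
      have := h1 0
      have := h2 0
      simp only [siteRange, Finset.mem_Ico]
      omega
    | succ i =>
      have := h1 (i + 1)
      have := h2 i
      have := h2 (i + 1)
      simp only [siteRange, Finset.mem_Ico]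
      omega

theorem numSur_eq_zero {l m : YoungDiagram} (h : ¬∀ i, m.colLen i ≤ l.colLen i) :
    (partitionGroup p l).numSur (partitionGroup p m) = 0 := by
  push Not at h
  obtain ⟨i, hi⟩ := h
  have := numSur_partitionGroup (p := p) l m (le_max_left (l.rowLen 0) (m.rowLen 0))
    (le_max_right _ _)
  rw [Finset.prod_eq_zero (i := i)] at this
  · exact_mod_cast this
  · rw [Finset.mem_range, lt_max_iff]
    right
    by_contra hc
    rw [YoungDiagram.colLen_eq_zero (not_lt.1 hc)] at hi
    omega
  · rw [invPoch, if_neg (not_le.2 hi), mul_zero, mul_zero]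

-- Terms vanish unless μ' ≤ λ', so the sum is finite and runs over a box, where a sum of products is
-- a product of sums.
open Classical in
theorem hasSum_inversionCoeff_mul_numSur (l n : YoungDiagram) :
    HasSum (fun m : {m : YoungDiagram // ConjInterlace m n} =>
      inversionCoeff p m n * ((partitionGroup p l).numSur (partitionGroup p m) : ℝ))
      (if l = n then 1 else 0) := by
  obtain ⟨L, hl, hn⟩ : ∃ L, l.rowLen 0 ≤ L ∧ n.rowLen 0 ≤ L :=
    ⟨_, le_max_left _ _, le_max_right _ _⟩
  let t : Fin (L + 1) → Finset ℕ := fun i => siteRange l.colLen n.colLen i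
  let ext : (Fin (L + 1) → ℕ) → ℕ → ℕ := fun b i => if h : i < L + 1 then b ⟨i, h⟩ else 0
  have hext1 : ∀ b i (h : i < L + 1), ext b i = b ⟨i, h⟩ := fun b i h => dif_pos h
  have hext0 : ∀ b i, ¬i < L + 1 → ext b i = 0 := fun b i h => dif_neg h
  have hl0 : ∀ i, L ≤ i → l.colLen i = 0 := fun i hi => YoungDiagram.colLen_eq_zero (hl.trans hi)
  have hn0 : ∀ i, L ≤ i → n.colLen i = 0 := fun i hi => YoungDiagram.colLen_eq_zero (hn.trans hi)
  have hmem : ∀ b ∈ Fintype.piFinset t, (∀ i, ext b i ≤ l.colLen i) ∧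
      ∀ i, n.colLen i ≤ ext b i ∧ ext b (i + 1) ≤ n.colLen i := by
    intro b hb
    refine mem_siteRange_iff.1 fun i => ?_
    by_cases hi : i < L + 1
    · rw [hext1 b i hi]
      exact Fintype.mem_piFinset.1 hb ⟨i, hi⟩
    · obtain ⟨k, rfl⟩ : ∃ k, i = k + 1 := ⟨i - 1, by omega⟩
      rw [hext0 b _ hi]
      simp [siteRange, hn0 (k + 1) (by omega)]
  have hanti : ∀ b ∈ Fintype.piFinset t, Antitone (ext b) := fun b hb =>
    antitone_nat_of_succ_le fun i => ((hmem b hb).2 i).2.trans ((hmem b hb).2 i).1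
  have hzero : ∀ b ∈ Fintype.piFinset t, ∀ i, L ≤ i → ext b i = 0 := fun b hb i hi =>
    Nat.le_zero.1 (((hmem b hb).1 i).trans (hl0 i hi).le)
  have hcol : ∀ (b) (hb : b ∈ Fintype.piFinset t) (i),
      (youngOfColLen (ext b) (hanti b hb) L).colLen i = ext b i := fun b hb i =>
    colLen_youngOfColLen (hanti b hb) (hzero b hb) i
  have hgmem : ∀ b : Fintype.piFinset t, ConjInterlace
      (youngOfColLen (ext b) (hanti b.1 b.2) L) n := fun b i => by
    rw [hcol b.1 b.2, hcol b.1 b.2]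
    exact (hmem b.1 b.2).2 i
  let g : Fintype.piFinset t → {m : YoungDiagram // ConjInterlace m n} := fun b =>
    ⟨youngOfColLen (ext b) (hanti b.1 b.2) L, hgmem b⟩
  have hgcol : ∀ b i, (g b).1.colLen i = ext b i := fun b i => hcol b.1 b.2 i
  have hg : Function.Injective g := by
    intro b b' h
    apply Subtype.ext
    funext i
    have := congrArg (fun m => m.1.colLen i) h
    simp only [hgcol] at this
    rwa [hext1 _ _ i.2, hext1 _ _ i.2] at this
  rw [← hg.hasSum_iff]
  · have hterm : ∀ b : Fintype.piFinset t,
        inversionCoeff p (g b).1 n *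
          ((partitionGroup p l).numSur (partitionGroup p (g b).1) : ℝ) =
        ∏ i : Fin (L + 1), siteTerm p l.colLen n.colLen i (b.1 i) := by
      intro b
      have hm : (g b).1.rowLen 0 ≤ L := by
        by_contra hc
        have := YoungDiagram.lt_colLen_iff_lt_rowLen.2 (not_le.1 hc)
        rw [hgcol, hzero b.1 b.2 L le_rfl] at this
        exact lt_irrefl _ this
      rw [inversionCoeff_mul_numSur l (g b).2 hl hm hn, Finset.prod_range]
      refine Finset.prod_congr rfl fun i _ => ?_
      rw [hgcol, hext1 _ _ i.2]
    have hsum : ∑ b : Fintype.piFinset t, ∏ i : Fin (L + 1), siteTerm p l.colLen n.colLen i (b.1 i) =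
        if l = n then (1 : ℝ) else 0 := by
      rw [Finset.sum_coe_sort (Fintype.piFinset t)
        (fun b => ∏ i : Fin (L + 1), siteTerm p l.colLen n.colLen i (b i)), ← Finset.prod_univ_sum,
        Fin.prod_univ_eq_prod_range (fun i => ∑ b ∈ siteRange l.colLen n.colLen i,
          siteTerm (p : ℝ) l.colLen n.colLen i b),
        prod_sum_siteTerm (Nat.one_lt_cast.2 hp.out.one_lt) fun i j h => l.colLen_anti i j h]
      refine if_congr ⟨fun h => YoungDiagram.ext_colLen fun i => ?_, fun h i _ => h ▸ rfl⟩ rfl rfl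
      by_cases hi : i < L + 1
      · exact h i hi
      · rw [hl0 i (by omega), hn0 i (by omega)]
    rw [← hsum]
    convert hasSum_fintype _ using 1
    exact Finset.sum_congr rfl fun b _ => (hterm b).symm
  -- A diagram not coming from the box has a column longer than that of λ, hence no surjections.
  · rintro ⟨m, hm⟩ hmg
    rw [numSur_eq_zero, Nat.cast_zero, mul_zero]
    intro hle
    apply hmg
    have hsite := mem_siteRange_iff.2 ⟨hle, hm⟩
    refine ⟨⟨fun i => m.colLen i, Fintype.mem_piFinset.2 fun i => hsite i⟩, Subtype.ext ?_⟩
    refine YoungDiagram.ext_colLen fun i => ?_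
    rw [hgcol]
    by_cases hi : i < L + 1
    · rw [hext1 _ i hi]
    · have := hle i
      rw [hl0 i (by omega)] at this
      rw [hext0 _ i hi]
      exact (Nat.le_zero.1 this).symm

end Inversion

/-! ### Passage to expectations and uniqueness -/

instance YoungDiagram.instCountable : Countable YoungDiagram :=
  Function.Injective.countable (f := YoungDiagram.cells) fun _ _ h => YoungDiagram.ext h

instance {p : ℕ} [Fact p.Prime] : Countable (FinAbPGroupClass p) :=
  Function.Surjective.countable (exists_partitionGroup_isoClass (p := p))

instance {p : ℕ} : DiscreteMeasurableSpace (FinAbPGroupClass p) := ⟨fun _ => trivial⟩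

theorem groupMoment_map {p : ℕ} {Ω : Type*} [MeasurableSpace Ω] (P : Measure Ω)
    {G : Ω → FinAbPGroupClass p} (hG : Measurable G) (H : FinAbPGroup p) :
    groupMoment (P.map G) id H = groupMoment P G H :=
  lintegral_map (Measurable.of_discrete (f := fun C : FinAbPGroupClass p => (C.numSur H : ENNReal))) hG

theorem integral_numSur {p : ℕ} {Ω : Type*} [MeasurableSpace Ω] (P : Measure Ω)
    {G : Ω → FinAbPGroupClass p} (hG : Measurable G) (H : FinAbPGroup p)
    (hfin : groupMoment P G H ≠ ⊤) :
    Integrable (fun ω => ((G ω).numSur H : ℝ)) P ∧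
      ∫ ω, ((G ω).numSur H : ℝ) ∂P = (groupMoment P G H).toReal := by
  have hm : Measurable fun ω => ((G ω).numSur H : ENNReal) :=
    (Measurable.of_discrete (f := fun C : FinAbPGroupClass p => (C.numSur H : ENNReal))).comp hG
  constructor
  · simpa using integrable_toReal_of_lintegral_ne_top hm.aemeasurable hfin
  · simpa [groupMoment] using integral_toReal hm.aemeasurable (ae_of_all P fun ω => by simp)

theorem hasSum_inversion {p : ℕ} [hp : Fact p.Prime] {Ω : Type*} [MeasurableSpace Ω]
    (P : Measure Ω) [IsProbabilityMeasure P] {G : Ω → FinAbPGroupClass p} (hG : Measurable G)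
    (hfin : ∀ H : FinAbPGroup p, groupMoment P G H ≠ ⊤) (n : YoungDiagram)
    (hs : Summable (fun m : {m : YoungDiagram // ConjInterlace m n} =>
      |inversionCoeff p m n * (groupMoment P G (partitionGroup p m)).toReal|)) :
    HasSum (fun m : {m : YoungDiagram // ConjInterlace m n} =>
      inversionCoeff p m n * (groupMoment P G (partitionGroup p m)).toReal)
      (P.real {ω | G ω = (partitionGroup p n).isoClass}) := by
  classical
  have hI := fun H => integral_numSur P hG H (hfin H)
  have key := hasSum_integral_of_summable_integral_norm (μ := P)
    (F := fun (m : {m : YoungDiagram // ConjInterlace m n}) ω =>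
      inversionCoeff p m n * ((G ω).numSur (partitionGroup p m) : ℝ))
    (fun m => (hI _).1.const_mul _) (by
      refine hs.congr fun m => ?_
      simp only [norm_mul, Real.norm_natCast, integral_const_mul, (hI _).2,
        abs_mul, abs_of_nonneg ENNReal.toReal_nonneg]
      rw [Real.norm_eq_abs])
  -- Orthogonality at the type of G ω turns the series into the indicator of the event G ≅ G_ν.
  have htsum : ∀ ω, ∑' m : {m : YoungDiagram // ConjInterlace m n},
      inversionCoeff p m n * ((G ω).numSur (partitionGroup p m) : ℝ) =
      {ω | G ω = (partitionGroup p n).isoClass}.indicator (fun _ => 1) ω := by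
    intro ω
    obtain ⟨l, hl⟩ := exists_partitionGroup_isoClass (G ω)
    rw [← hl, Set.indicator_apply]
    refine (hasSum_inversionCoeff_mul_numSur l n).tsum_eq.trans ?_
    refine if_congr ((partitionGroup_isoClass_injective (p := p)).eq_iff.symm.trans ?_) rfl rfl
    change _ ↔ G ω = _
    rw [← hl]
  simp only [htsum, integral_const_mul, (hI _).2] at key
  have hset : MeasurableSet {ω | G ω = (partitionGroup p n).isoClass} :=
    hG (MeasurableSet.singleton (partitionGroup p n).isoClass)
  rwa [integral_indicator_const _ hset, smul_eq_mul, mul_one] at key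

theorem theorem1p1 (p : ℕ) [Fact p.Prime]
    {Ω : Type*} [MeasurableSpace Ω] (P : Measure Ω) [IsProbabilityMeasure P]
    (G : Ω → FinAbPGroupClass p) (hG : Measurable G)
    (hfin : ∀ H : FinAbPGroup p, groupMoment P G H ≠ ⊤) :
    -- the inversion formula, for every partition whose sum converges absolutely
    (∀ ν : YoungDiagram,
      Summable (fun μ : {μ : YoungDiagram // ConjInterlace μ ν} =>
        |inversionCoeff p μ ν * (groupMoment P G (partitionGroup p μ)).toReal|) →
      HasSum (fun μ : {μ : YoungDiagram // ConjInterlace μ ν} =>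
        inversionCoeff p μ ν * (groupMoment P G (partitionGroup p μ)).toReal)
        (P.real {ω | G ω = (partitionGroup p ν).isoClass})) ∧
    -- if all the sums converge absolutely, the law of `G` is the unique probability
    -- measure on the set of isomorphism classes that has the same moments
    ((∀ ν : YoungDiagram,
      Summable (fun μ : {μ : YoungDiagram // ConjInterlace μ ν} =>
        |inversionCoeff p μ ν * (groupMoment P G (partitionGroup p μ)).toReal|)) →
      ∀ Q : Measure (FinAbPGroupClass p), IsProbabilityMeasure Q →
        ((∀ H : FinAbPGroup p, groupMoment Q id H = groupMoment P G H) ↔ Q = P.map G)) := by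
  have hinv := hasSum_inversion P hG hfin
  refine ⟨hinv, fun hs Q hQ => ⟨fun hmom => ?_, ?_⟩⟩
  · have : IsProbabilityMeasure (P.map G) := Measure.isProbabilityMeasure_map hG.aemeasurable
    refine Measure.ext_of_singleton fun C => ?_
    obtain ⟨n, rfl⟩ := exists_partitionGroup_isoClass C
    -- The identity map is a random group of law Q with the same moments, so the same series
    -- computes its point masses.
    have hQn := hasSum_inversion Q measurable_id (fun H => hmom H ▸ hfin H) n
    simp only [hmom] at hQn
    have hreal := (hQn (hs n)).unique (hinv n (hs n))
    rw [Measure.map_apply hG (MeasurableSet.singleton _)]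
    exact (measureReal_eq_measureReal_iff (measure_ne_top _ _) (measure_ne_top _ _)).1 hreal
  · rintro rfl H
    exact groupMoment_map P hG H

end
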